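/- Theorem. Let $D=\{z\in\mathbb{C}:|z|<1\}$. All integrals of functions of a real variable are Henstock--Kurzweil integrals. For $f:\mathbb{R}\to\mathbb{R}$ that is $2\pi$-periodic and Henstock--Kurzweil integrable over every compact interval, let $$\|f\|:=\sup_{I}\Bigl|\int_I f\Bigr|$$ be its Alexiewicz norm, the supremum being over all intervals $I\subset\mathbb{R}$ of length at most $2\pi$. Let $\mathcal{HK}$ be the set of all such $f$ with $\|f\|<\infty$. For $u:D\to\mathbb{R}$ and $0\le r<1$ write $u_r(\theta):=u(re^{i\theta})$, and let $$h^{\mathcal{HK}}:=\Bigl\{u:D\to\mathbb{R}\;\Bigm|\;\Delta u=0\text{ in }D,\ \|u\|_{\mathcal{HK}}:=\sup_{0\le r<1}\|u_r\|<\infty\Bigr\}.$$ For $f\in\mathcal{HK}$ the Poisson integral of $f$ is $$P[f](re^{i\theta}):=\int_{-\pi}^{\pi}f(\phi)\,\Phi_r(\phi-\theta)\,d\phi,\qquad \Phi_r(\theta):=\frac{1-r^2}{2\pi(1-2r\cos\theta+r^2)}\qquad(0\le r<1).$$ Then $P[f]$ exists at every point of $D$ and belongs to $h^{\mathcal{HK}}$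 for every $f\in\mathcal{HK}$, and the mapping $P:\mathcal{HK}\to h^{\mathcal{HK}}$, $f\mapsto P[f]$, is an isometry into, but not onto, $h^{\mathcal{HK}}$. That is, $\|P[f]\|_{\mathcal{HK}}=\|f\|$ and $\|P[f]-P[g]\|_{\mathcal{HK}}=\|f-g\|$ for all $f,g\in\mathcal{HK}$, and there is $u\in h^{\mathcal{HK}}$ such that $u\ne P[f]$ for every $f\in\mathcal{HK}$. -/

import Mathlib

open scoped ENNReal

noncomputable section

namespace PoissonHK

/-- The interval with end points `a < b`, as a one-dimensional box. -/
def interval (a b : ℝ) (h : a < b) : BoxIntegral.Box (Fin 1) where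
  lower := fun _ => a
  upper := fun _ => b
  lower_lt_upper := fun _ => h

/-- Henstock--Kurzweil integrability of `f` over the interval `[a, b]`: the Riemann sums of `f`
over tagged partitions of `[a, b]` (each tag lying in its closed subinterval) subordinate to a
positive gauge converge. Nothing is required of a degenerate interval. -/
def HKIntegrable (f : ℝ → ℝ) (a b : ℝ) : Prop :=
  ∀ h : a < b, BoxIntegral.Integrable (interval a b h) BoxIntegral.IntegrationParams.Henstock
    (fun x : Fin 1 → ℝ => f (x 0)) BoxIntegral.BoxAdditiveMap.volume

/-- The Henstock--Kurzweil integral of `f` over `[a, b]`, for `a ≤ b` (zero if `a = b`). -/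
def hkIntegral (f : ℝ → ℝ) (a b : ℝ) : ℝ :=
  if h : a < b then
    BoxIntegral.integral (interval a b h) BoxIntegral.IntegrationParams.Henstock
      (fun x : Fin 1 → ℝ => f (x 0)) BoxIntegral.BoxAdditiveMap.volume
  else 0

/-- The Alexiewicz norm `sup_I |∫_I f|` over the intervals `I ⊆ ℝ` of length at most `2π`,
as an extended nonnegative real. -/
def alexiewiczNorm (f : ℝ → ℝ) : ℝ≥0∞ :=
  ⨆ (a : ℝ) (b : ℝ) (_ : a ≤ b ∧ b - a ≤ 2 * Real.pi), ENNReal.ofReal |hkIntegral f a b|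

/-- The space of `2π`-periodic functions that are Henstock--Kurzweil integrable over every
compact interval and have finite Alexiewicz norm. -/
def HK : Set (ℝ → ℝ) :=
  {f | Function.Periodic f (2 * Real.pi) ∧ (∀ a b : ℝ, HKIntegrable f a b) ∧
    alexiewiczNorm f < ⊤}

/-- The open unit disc. -/
def disc : Set ℂ := Metric.ball 0 1

/-- The Poisson kernel `Φ_r(θ)`. -/
def circlePoissonKernel (r θ : ℝ) : ℝ :=
  (1 - r ^ 2) / (2 * Real.pi * (1 - 2 * r * Real.cos θ + r ^ 2))

/-- The Poisson integral `P[f](z) = ∫_{-π}^{π} f(φ) Φ_r(φ - θ) dφ`, where `z = r e^{iθ}`. -/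
def poissonIntegral (f : ℝ → ℝ) (z : ℂ) : ℝ :=
  hkIntegral (fun φ => f φ * circlePoissonKernel ‖z‖ (φ - Complex.arg z)) (-Real.pi) Real.pi

/-- The function `u_r(θ) = u(r e^{iθ})`. -/
def circleSlice (u : ℂ → ℝ) (r : ℝ) : ℝ → ℝ :=
  fun θ => u (r * Complex.exp (θ * Complex.I))

/-- The norm `sup_{0 ≤ r < 1} ‖u_r‖`, where `‖·‖` is the Alexiewicz norm. -/
def hardyNorm (u : ℂ → ℝ) : ℝ≥0∞ :=
  ⨆ (r : ℝ) (_ : 0 ≤ r ∧ r < 1), alexiewiczNorm (circleSlice u r)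

/-- The harmonic Hardy space of the Alexiewicz norm. A function on the disc is represented by a
function on `ℂ`, of which only the values on the disc matter. -/
def hHK : Set (ℂ → ℝ) :=
  {u | InnerProductSpace.HarmonicOnNhd u disc ∧ hardyNorm u < ⊤}

end PoissonHK

end

/-
Let `F` be an indefinite integral of `f`. It is continuous, and subtracting a constant `m` from `f`
makes `F` `2π`-periodic. Integration by parts against the smooth kernel turns `P[f - m]` into the
angular derivative of the Poisson integral of the continuous function `F`, which is the real part
of a holomorphic Herglotz integral; hence `P[f]` is harmonic and
`∫_a^b P[f]_r = ∫_{-π}^{π} Φ_r(φ) (F(φ + b) - F(φ + a)) dφ`.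
Since `Φ_r` is a positive kernel of mass one, `‖P[f]_r‖ ≤ ‖f‖`; since it is an approximate
identity, the right-hand side tends to `F b - F a` as `r → 1`, which gives the reverse inequality.
The Poisson kernel itself lies in `hHK`, but its mass concentrates at `θ = 0`: were it `P[f]`, then
`F δ - F (-δ) = 1` for all small `δ > 0`, contradicting continuity of `F`.
-/

namespace PoissonHK

open BoxIntegral Filter Topology
open BoxIntegral.IntegrationParams (Henstock)

section Translation

variable {ι : Type*} {t : ι → ℝ}

/-- The translate `J + t` of a box, used to change variables in Henstock integrals. -/
def translateBox (t : ι → ℝ) (J : Box ι) : Box ι where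
  lower := J.lower + t
  upper := J.upper + t
  lower_lt_upper i := add_lt_add_left (J.lower_lt_upper i) (t i)

theorem mem_translateBox {x : ι → ℝ} {J : Box ι} : x ∈ translateBox t J ↔ x - t ∈ J := by
  simp [Box.mem_def, translateBox, lt_sub_iff_add_lt]

theorem mem_Icc_translateBox {x : ι → ℝ} {J : Box ι} :
    x ∈ Box.Icc (translateBox t J) ↔ x - t ∈ Box.Icc J := by
  simp [Box.Icc_def, translateBox, le_sub_iff_add_le]

theorem translateBox_neg_translateBox (t : ι → ℝ) (J : Box ι) :
    translateBox (-t) (translateBox t J) = J := by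
  ext x
  simp [mem_translateBox]

/-- The translate of a tagged prepartition: every box and every tag is moved by `t`. -/
def translateTaggedPrepartition (t : ι → ℝ) {I : Box ι} (π : TaggedPrepartition I) :
    TaggedPrepartition (translateBox t I) where
  boxes := π.boxes.map
    ⟨translateBox t, Function.LeftInverse.injective (translateBox_neg_translateBox t)⟩
  le_of_mem' := by
    simp only [Finset.mem_map, Function.Embedding.coeFn_mk]
    rintro _ ⟨J, hJ, rfl⟩ x hx
    exact mem_translateBox.2 (π.le_of_mem' J hJ (mem_translateBox.1 hx))
  pairwiseDisjoint := by
    simp only [Set.Pairwise, Finset.coe_map, Function.Embedding.coeFn_mk, Set.mem_image]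
    rintro _ ⟨J, hJ, rfl⟩ _ ⟨J', hJ', rfl⟩ hne
    have hdisjoint := π.pairwiseDisjoint hJ hJ' fun h => hne (h ▸ rfl)
    exact Set.disjoint_left.2 fun x hx hx' => Set.disjoint_left.1 hdisjoint
      (mem_translateBox.1 hx) (mem_translateBox.1 hx')
  tag J := π.tag (translateBox (-t) J) + t
  tag_mem_Icc J := mem_Icc_translateBox.2 (by simpa using π.tag_mem_Icc _)

theorem translateTaggedPrepartition_tag (t : ι → ℝ) {I : Box ι} (π : TaggedPrepartition I)
    (J : Box ι) : (translateTaggedPrepartition t π).tag (translateBox t J) = π.tag J + t := by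
  simp [translateTaggedPrepartition, translateBox_neg_translateBox]

theorem forall_mem_translateTaggedPrepartition {I : Box ι} {π : TaggedPrepartition I}
    {p : Box ι → Prop} :
    (∀ J ∈ translateTaggedPrepartition t π, p J) ↔ ∀ J ∈ π, p (translateBox t J) :=
  Finset.forall_mem_map

theorem isPartition_translateTaggedPrepartition {I : Box ι} {π : TaggedPrepartition I}
    (hπ : π.IsPartition) : (translateTaggedPrepartition t π).IsPartition := fun _ hx =>
  let ⟨J, hJ, hxJ⟩ := hπ _ (mem_translateBox.1 hx)
  ⟨translateBox t J, Finset.mem_map_of_mem _ hJ, mem_translateBox.2 hxJ⟩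

theorem isHenstock_translateTaggedPrepartition {I : Box ι} {π : TaggedPrepartition I}
    (hπ : π.IsHenstock) : (translateTaggedPrepartition t π).IsHenstock := by
  refine forall_mem_translateTaggedPrepartition.2 fun J hJ => ?_
  rw [translateTaggedPrepartition_tag, mem_Icc_translateBox, add_sub_cancel_right]
  exact hπ J hJ

theorem integralSum_translateTaggedPrepartition {E F : Type*}
    [NormedAddCommGroup E] [NormedSpace ℝ E] [NormedAddCommGroup F] [NormedSpace ℝ F]
    {f : (ι → ℝ) → E} {vol : ι →ᵇᵃ E →L[ℝ] F}
    (hvol : ∀ J, vol (translateBox t J) = vol J) {I : Box ι}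
    (π : TaggedPrepartition I) : integralSum f vol (translateTaggedPrepartition t π) =
      integralSum (fun x => f (x + t)) vol π := by
  refine (Finset.sum_map _ _ _).trans (Finset.sum_congr rfl fun J _ => ?_)
  simp only [Function.Embedding.coeFn_mk, translateTaggedPrepartition_tag, hvol]

end Translation

section HenstockIntegral

variable {ι E F : Type*} [Fintype ι] [NormedAddCommGroup E] [NormedSpace ℝ E]
  [NormedAddCommGroup F] [NormedSpace ℝ F]

theorem henstock_memBaseSet_iff {I : Box ι} {c : NNReal} {r : (ι → ℝ) → Set.Ioi (0 : ℝ)}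
    {π : TaggedPrepartition I} :
    Henstock.MemBaseSet I c r π ↔ π.IsSubordinate r ∧ π.IsHenstock :=
  ⟨fun h => ⟨h.isSubordinate, h.isHenstock rfl⟩,
    fun h => ⟨h.1, fun _ => h.2, fun h => absurd h Bool.false_ne_true,
      fun h => absurd h Bool.false_ne_true⟩⟩

theorem sum_abs_sub_integral_le {I : Box ι} {l : IntegrationParams} {f : (ι → ℝ) → E}
    {vol : ι →ᵇᵃ E →L[ℝ] ℝ} (h : Integrable I l f vol) {ε : ℝ} (hε : 0 < ε) {c : NNReal}
    {π : TaggedPrepartition I} (hπ : l.MemBaseSet I c (h.convergenceR ε c) π) :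
    ∑ J ∈ π.boxes, |vol J (f (π.tag J)) - integral J l f vol| ≤ 2 * ε := by
  classical
  set D : Box ι → ℝ := fun J => vol J (f (π.tag J)) - integral J l f vol
  have abs_sum_filter_le (p : Box ι → Prop) [DecidablePred p] :
      |∑ J ∈ π.boxes with p J, D J| ≤ ε := by
    have hfilter := h.dist_integralSum_sum_integral_le_of_memBaseSet hε (hπ.filter p)
    rw [Real.dist_eq, integralSum, ← Finset.sum_sub_distrib] at hfilter
    convert! hfilter using 3
    ext J
    exact Finset.mem_filter.trans π.mem_filter.symm
  have nonneg_part : ∑ J ∈ π.boxes with 0 ≤ D J, |D J| ≤ ε := by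
    rw [Finset.sum_congr rfl fun J hJ => abs_of_nonneg (Finset.mem_filter.1 hJ).2]
    exact (le_abs_self _).trans (abs_sum_filter_le _)
  have neg_part : ∑ J ∈ π.boxes with ¬ 0 ≤ D J, |D J| ≤ ε := by
    rw [Finset.sum_congr rfl fun J hJ => abs_of_neg (not_le.1 (Finset.mem_filter.1 hJ).2),
      Finset.sum_neg_distrib]
    exact (neg_le_abs _).trans (abs_sum_filter_le _)
  rw [← Finset.sum_filter_add_sum_filter_not π.boxes (fun J => 0 ≤ D J)]
  linarith

theorem exists_forall_dist_integral_le [CompleteSpace F] {I : Box ι} {l : IntegrationParams}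
    {f : (ι → ℝ) → E} {vol : ι →ᵇᵃ E →L[ℝ] F} (h : Integrable I l f vol)
    (hl : l.bDistortion = false) {x : ι → ℝ} (hx : x ∈ Box.Icc I) {ε : ℝ} (hε : 0 < ε) :
    ∃ δ > 0, ∀ J ≤ I, x ∈ Box.Icc J → Box.Icc J ⊆ Metric.closedBall x δ →
      dist (vol J (f x)) (integral J l f vol) ≤ ε := by
  refine ⟨h.convergenceR ε 0 x, (h.convergenceR ε 0 x).2, fun J hJ hxJ hball => ?_⟩
  have hmem : l.MemBaseSet I 0 (h.convergenceR ε 0)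
      (TaggedPrepartition.single I J hJ x hx) :=
    ⟨(TaggedPrepartition.isSubordinate_single _ _).2 hball,
      fun _ => (TaggedPrepartition.isHenstock_single_iff _ _).2 hxJ,
      fun h => by simp [hl] at h, fun h => by simp [hl] at h⟩
  simpa only [integralSum, TaggedPrepartition.single, Prepartition.single, Finset.sum_singleton]
    using h.dist_integralSum_sum_integral_le_of_memBaseSet hε hmem

theorem hasIntegral_smul_of_hasIntegral_toSMul {I : Box ι} {l : IntegrationParams}
    {f : (ι → ℝ) → E} {g : (ι → ℝ) → ℝ} {vol : ι →ᵇᵃ E →L[ℝ] ℝ} {Φ : ι →ᵇᵃ ℝ} {M y : ℝ}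
    (hf : ∀ J ≤ I, HasIntegral J l f vol (Φ J)) (hM : ∀ x ∈ Box.Icc I, |g x| ≤ M)
    (hg : HasIntegral I l g Φ.toSMul y) : HasIntegral I l (fun x => g x • f x) vol y := by
  have hfI : Integrable I l f vol := (hf I le_rfl).integrable
  have hM0 : 0 ≤ M := (abs_nonneg _).trans (hM _ I.upper_mem_Icc)
  refine HasIntegral.of_mul (M * 2 + 1) fun ε hε => ?_
  obtain ⟨r, hr, hgr⟩ := hasIntegral_iff.1 hg ε hε
  refine ⟨fun c x => min (r c x) (hfI.convergenceR ε c x),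
    fun c => (hr c).min (hfI.convergenceR_cond ε c), fun c π hπ hp => ?_⟩
  have hstieltjes := hgr c π (hπ.mono' I le_rfl le_rfl fun J _ => min_le_left _ _) hp
  have hsaks := sum_abs_sub_integral_le hfI hε
    (hπ.mono' I le_rfl le_rfl fun J _ => min_le_right _ _)
  have hcompare : |integralSum (fun x => g x • f x) vol π - integralSum g Φ.toSMul π| ≤
      M * (2 * ε) :=
    calc |integralSum (fun x => g x • f x) vol π - integralSum g Φ.toSMul π|
      _ = |∑ J ∈ π.boxes, g (π.tag J) * (vol J (f (π.tag J)) - integral J l f vol)| := by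
          rw [integralSum, integralSum, ← Finset.sum_sub_distrib]
          congr 1
          refine Finset.sum_congr rfl fun J hJ => ?_
          rw [(hf J (π.le_of_mem hJ)).integral_eq, map_smul, BoxAdditiveMap.toSMul_apply,
            smul_eq_mul, smul_eq_mul, mul_sub, mul_comm (Φ J)]
      _ ≤ ∑ J ∈ π.boxes, M * |vol J (f (π.tag J)) - integral J l f vol| := by
          refine (Finset.abs_sum_le_sum_abs _ _).trans (Finset.sum_le_sum fun J _ => ?_)
          rw [abs_mul]
          gcongr
          exact hM _ (π.tag_mem_Icc J)
      _ ≤ M * (2 * ε) := by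
          rw [← Finset.mul_sum]
          gcongr
  rw [Real.dist_eq] at hstieltjes ⊢
  calc |integralSum (fun x => g x • f x) vol π - y|
    _ ≤ M * (2 * ε) + ε := (abs_sub_le _ _ _).trans (add_le_add hcompare hstieltjes)
    _ = (M * 2 + 1) * ε := by ring

theorem volume_translateBox (t : ι → ℝ) (J : Box ι) :
    (BoxAdditiveMap.volume (translateBox t J) : E →L[ℝ] E) = BoxAdditiveMap.volume J := by
  ext x
  simp [BoxAdditiveMap.volume_apply, translateBox]

theorem isSubordinate_translateTaggedPrepartition {t : ι → ℝ} {I : Box ι}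
    {π : TaggedPrepartition I} {r : (ι → ℝ) → Set.Ioi (0 : ℝ)}
    (hπ : π.IsSubordinate fun x => r (x + t)) :
    (translateTaggedPrepartition t π).IsSubordinate r := by
  refine forall_mem_translateTaggedPrepartition.2 fun J hJ x hx => ?_
  rw [translateTaggedPrepartition_tag, Metric.mem_closedBall, ← dist_sub_right x _ t,
    add_sub_cancel_right]
  exact hπ J hJ (mem_Icc_translateBox.1 hx)

theorem hasIntegral_henstock_comp_add {f : (ι → ℝ) → E} {vol : ι →ᵇᵃ E →L[ℝ] F} {t : ι → ℝ}
    (hvol : ∀ J, vol (translateBox t J) = vol J) {I : Box ι} {y : F}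
    (h : HasIntegral (translateBox t I) Henstock f vol y) :
    HasIntegral I Henstock (fun x => f (x + t)) vol y := by
  refine hasIntegral_iff.2 fun ε hε => ?_
  obtain ⟨r, -, hr⟩ := hasIntegral_iff.1 h ε hε
  refine ⟨fun c x => r c (x + t), fun c => Henstock.rCond_of_bRiemann_eq_false rfl,
    fun c π hπ hp => ?_⟩
  obtain ⟨hsub, hhen⟩ := henstock_memBaseSet_iff.1 hπ
  rw [← integralSum_translateTaggedPrepartition hvol]
  exact hr c _ (henstock_memBaseSet_iff.2 ⟨isSubordinate_translateTaggedPrepartition hsub,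
    isHenstock_translateTaggedPrepartition hhen⟩) (isPartition_translateTaggedPrepartition hp)

end HenstockIntegral

section Stieltjes

/-- The box-additive function `J ↦ F (max J) - F (min J)` on intervals, for a function `F` on `ℝ`:
the integrator of the Stieltjes integral against `dF`. -/
def endpointDiff {M : Type*} [AddCommGroup M] (F : ℝ → M) : BoxAdditiveMap (Fin 1) M ⊤ :=
  BoxAdditiveMap.ofMapSplitAdd (fun J => F (J.upper 0) - F (J.lower 0)) ⊤ fun J _ i x hx => by
    obtain rfl : i = 0 := Subsingleton.elim _ _
    simp only [Box.splitLower_def hx, Box.splitUpper_def hx, Function.update_self,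
      ← WithBot.some_eq_coe, Option.elim']
    abel

theorem endpointDiff_apply {M : Type*} [AddCommGroup M] (F : ℝ → M) (J : Box (Fin 1)) :
    endpointDiff F J = F (J.upper 0) - F (J.lower 0) := rfl

theorem toSMul_endpointDiff_id {E : Type*} [NormedAddCommGroup E] [NormedSpace ℝ E] :
    ((endpointDiff id).toSMul : BoxAdditiveMap (Fin 1) (E →L[ℝ] E) ⊤) =
      BoxAdditiveMap.volume := by
  ext J
  simp [BoxAdditiveMap.toSMul_apply, endpointDiff_apply, BoxAdditiveMap.volume_apply]

theorem dist_endpoints_le_of_Icc_subset_closedBall {J : Box (Fin 1)} {x : Fin 1 → ℝ} {δ : ℝ}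
    (hJ : Box.Icc J ⊆ Metric.closedBall x δ) :
    dist (J.lower 0) (x 0) ≤ δ ∧ dist (J.upper 0) (x 0) ≤ δ :=
  ⟨(dist_le_pi_dist _ x 0).trans (hJ J.lower_mem_Icc),
    (dist_le_pi_dist _ x 0).trans (hJ J.upper_mem_Icc)⟩

theorem hasIntegral_toSMul_endpointDiff {E : Type*} [NormedAddCommGroup E] [NormedSpace ℝ E]
    {V : ℝ → ℝ} {k ψ : ℝ → E} (h : ∀ x, HasDerivAt (fun y => V y • k x - ψ y) 0 x)
    (I : Box (Fin 1)) :
    HasIntegral I Henstock (fun x => k (x 0)) (endpointDiff V).toSMul (endpointDiff ψ I) := by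
  refine HasIntegral.of_le_Henstock_of_forall_isLittleO le_rfl
    ((endpointDiff id).restrict I le_top) (fun J => ?_) ((endpointDiff ψ).restrict I le_top) ∅
    Set.countable_empty (by simp) fun _ x _ ε hε => ?_
  · simpa [endpointDiff_apply] using (J.lower_lt_upper 0).le
  obtain ⟨δ, hδ, hψ⟩ := Metric.eventually_nhds_iff_ball.1 ((h (x 0)).isLittleO.def hε)
  simp only [smul_zero, sub_zero] at hψ
  refine ⟨δ / 2, half_pos hδ, fun J _ hball hxJ _ => ?_⟩
  have hend := dist_endpoints_le_of_Icc_subset_closedBall hball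
  have hlower := hψ _ (hend.1.trans_lt (half_lt_self hδ))
  have hupper := hψ _ (hend.2.trans_lt (half_lt_self hδ))
  rw [Real.norm_of_nonpos (sub_nonpos.2 (hxJ.1 0))] at hlower
  rw [Real.norm_of_nonneg (sub_nonneg.2 (hxJ.2 0))] at hupper
  simp only [BoxAdditiveMap.toSMul_apply, BoxAdditiveMap.restrict_apply, endpointDiff_apply, id]
  set Ψ : ℝ → E := fun y => V y • k (x 0) - ψ y
  calc dist ((V (J.upper 0) - V (J.lower 0)) • k (x 0)) (ψ (J.upper 0) - ψ (J.lower 0))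
    _ = ‖(Ψ (J.upper 0) - Ψ (x 0)) - (Ψ (J.lower 0) - Ψ (x 0))‖ := by
        rw [dist_eq_norm, sub_smul]
        congr 1
        simp only [Ψ]
        abel
    _ ≤ ε * (J.upper 0 - x 0) + ε * -(J.lower 0 - x 0) :=
        (norm_sub_le _ _).trans (add_le_add hupper hlower)
    _ = ε * (J.upper 0 - J.lower 0) := by ring

end Stieltjes

section Primitive

theorem interval_lower_upper (J : Box (Fin 1)) :
    interval (J.lower 0) (J.upper 0) (J.lower_lt_upper 0) = J := by
  ext x
  simp [Box.mem_def, interval]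

theorem hkIntegral_self (f : ℝ → ℝ) (a : ℝ) : hkIntegral f a a = 0 :=
  dif_neg (lt_irrefl a)

theorem hkIntegral_lower_upper (f : ℝ → ℝ) (J : Box (Fin 1)) :
    hkIntegral f (J.lower 0) (J.upper 0) =
      integral J Henstock (fun x => f (x 0)) BoxAdditiveMap.volume := by
  rw [hkIntegral, dif_pos (J.lower_lt_upper 0), interval_lower_upper]

theorem hkIntegral_add_adjacent {f : ℝ → ℝ} {a b c : ℝ} (hf : HKIntegrable f a c)
    (hab : a ≤ b) (hbc : b ≤ c) :
    hkIntegral f a b + hkIntegral f b c = hkIntegral f a c := by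
  rcases hab.eq_or_lt with rfl | hab
  · rw [hkIntegral_self, zero_add]
  rcases hbc.eq_or_lt with rfl | hbc
  · rw [hkIntegral_self, add_zero]
  have hac := hab.trans hbc
  have hb : b ∈ Set.Ioo ((interval a c hac).lower 0) ((interval a c hac).upper 0) := ⟨hab, hbc⟩
  have hsplit := (hf hac).toBoxAdditive.map_split_add le_rfl 0 b
  rw [Box.splitLower_def hb, Box.splitUpper_def hb] at hsplit
  simp only [Option.elim', Integrable.toBoxAdditive_apply, ← hkIntegral_lower_upper] at hsplit
  simpa [interval] using hsplit

/-- `F` is an indefinite Henstock--Kurzweil integral of `f`: over every compact interval `f` is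
integrable and its integral is the increment of `F`. -/
def IsHKPrimitive (F f : ℝ → ℝ) : Prop :=
  ∀ J : Box (Fin 1), HasIntegral J Henstock (fun x => f (x 0)) BoxAdditiveMap.volume
    (endpointDiff F J)

theorem exists_isHKPrimitive {f : ℝ → ℝ} (hf : ∀ a b, HKIntegrable f a b) :
    ∃ F, IsHKPrimitive F f := by
  refine ⟨fun x => hkIntegral f 0 x - hkIntegral f x 0, fun J => ?_⟩
  have hJ : Integrable J Henstock (fun x => f (x 0)) BoxAdditiveMap.volume := by
    simpa only [interval_lower_upper] using hf _ _ (J.lower_lt_upper 0)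
  convert hJ.hasIntegral using 1
  rw [← hkIntegral_lower_upper, endpointDiff_apply]
  generalize J.lower 0 = a, J.upper 0 = b, (J.lower_lt_upper 0).le = hab
  have reversed {x y : ℝ} (h : x ≤ y) : hkIntegral f y x = 0 := dif_neg h.not_gt
  rcases le_total 0 a with ha | ha <;> rcases le_total 0 b with hb | hb <;>
    simp only [reversed, ha, hb]
  · linarith [hkIntegral_add_adjacent (hf 0 b) ha hab]
  · obtain rfl : a = 0 := le_antisymm (hab.trans hb) ha
    obtain rfl : b = 0 := le_antisymm hb hab
    simp only [hkIntegral_self, sub_self]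
  · linarith [hkIntegral_add_adjacent (hf a b) ha hb]
  · linarith [hkIntegral_add_adjacent (hf a 0) hab hb]

theorem isHKPrimitive_of_hasDerivAt {F f : ℝ → ℝ} (h : ∀ x, HasDerivAt F (f x) x) :
    IsHKPrimitive F f := fun J => by
  rw [← toSMul_endpointDiff_id]
  refine hasIntegral_toSMul_endpointDiff (fun x => ?_) J
  simpa using ((hasDerivAt_id x).mul_const (f x)).fun_sub (h x)

namespace IsHKPrimitive

variable {F f G g : ℝ → ℝ}

theorem hkIntegrable (hF : IsHKPrimitive F f) (a b : ℝ) : HKIntegrable f a b :=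
  fun _ => (hF _).integrable

theorem hkIntegral_eq (hF : IsHKPrimitive F f) {a b : ℝ} (hab : a ≤ b) :
    hkIntegral f a b = F b - F a := by
  rcases hab.eq_or_lt with rfl | hab
  · rw [hkIntegral_self, sub_self]
  · rw [hkIntegral, dif_pos hab, (hF _).integral_eq]
    rfl

theorem sub (hF : IsHKPrimitive F f) (hG : IsHKPrimitive G g) :
    IsHKPrimitive (F - G) (f - g) := fun J => by
  have hincrement : endpointDiff (F - G) J = endpointDiff F J - endpointDiff G J :=
    sub_sub_sub_comm _ _ _ _
  exact hincrement ▸ (hF J).sub (hG J)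

theorem sub_eq_sub (hF : IsHKPrimitive F f) (hG : IsHKPrimitive G f) (a b : ℝ) :
    F b - F a = G b - G a := by
  rcases le_total a b with hab | hab
  · rw [← hF.hkIntegral_eq hab, hG.hkIntegral_eq hab]
  · rw [← neg_sub, ← hF.hkIntegral_eq hab, hG.hkIntegral_eq hab, neg_sub]

theorem comp_add_const (hF : IsHKPrimitive F f) (t : ℝ) :
    IsHKPrimitive (fun x => F (x + t)) (fun x => f (x + t)) := fun J =>
  hasIntegral_henstock_comp_add (f := fun x => f (x 0)) (t := fun _ => t)
    (volume_translateBox _) (hF (translateBox (fun _ => t) J))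

theorem exists_forall_abs_mul_sub_le (hF : IsHKPrimitive F f) (x : ℝ) {ε : ℝ} (hε : 0 < ε) :
    ∃ δ > 0, ∀ a b, a < b → a ∈ Metric.ball x δ → b ∈ Metric.ball x δ → x ∈ Set.Icc a b →
      |(b - a) * f x - (F b - F a)| ≤ ε := by
  have hx : x - 1 < x + 1 := by linarith
  obtain ⟨δ, hδ, hlocal⟩ := exists_forall_dist_integral_le (hF (interval _ _ hx)).integrable rfl
    (x := fun _ => x) ⟨fun _ => by simp [interval], fun _ => by simp [interval]⟩ hε
  refine ⟨min δ 1, lt_min hδ one_pos, fun a b hab ha hb hxab => ?_⟩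
  rw [Real.ball_eq_Ioo, Set.mem_Ioo] at ha hb
  have hδ_le := min_le_left δ 1
  have hone_le := min_le_right δ 1
  have hle : interval a b hab ≤ interval _ _ hx :=
    Box.le_iff_bounds.2 ⟨fun _ => by simp only [interval]; linarith,
      fun _ => by simp only [interval]; linarith⟩
  have hball : Box.Icc (interval a b hab) ⊆ Metric.closedBall (fun _ => x) δ := fun z hz =>
    (dist_pi_le_iff hδ.le).2 fun i => by
      have hlower : a ≤ z i := hz.1 i
      have hupper : z i ≤ b := hz.2 i
      rw [Real.dist_eq, abs_le]
      constructor <;> linarith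
  have hsum := hlocal _ hle ⟨fun _ => hxab.1, fun _ => hxab.2⟩ hball
  rw [(hF _).integral_eq, Real.dist_eq] at hsum
  simpa [BoxAdditiveMap.volume_apply, endpointDiff_apply, interval] using hsum

theorem tendsto_sub_sub_mul (hF : IsHKPrimitive F f) (x : ℝ) :
    Tendsto (fun y => F y - F x - (y - x) * f x) (𝓝 x) (𝓝 0) := by
  refine Metric.tendsto_nhds_nhds.2 fun ε hε => ?_
  obtain ⟨δ, hδ, hlocal⟩ := hF.exists_forall_abs_mul_sub_le x (half_pos hε)
  have hx := Metric.mem_ball_self (x := x) hδ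
  refine ⟨δ, hδ, fun y hy => lt_of_le_of_lt ?_ (half_lt_self hε)⟩
  rw [dist_zero_right, Real.norm_eq_abs]
  rcases lt_trichotomy x y with hxy | rfl | hxy
  · rw [abs_sub_comm]
    exact hlocal x y hxy hx hy ⟨le_rfl, hxy.le⟩
  · simpa using (half_pos hε).le
  · refine (hlocal y x hxy hy hx ⟨hxy.le, le_rfl⟩).trans' (le_of_eq (congrArg abs ?_))
    ring

theorem continuous (hF : IsHKPrimitive F f) : Continuous F :=
  continuous_iff_continuousAt.2 fun x => by
    have hlin : Tendsto (fun y => F x + (y - x) * f x) (𝓝 x) (𝓝 (F x + (x - x) * f x)) :=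
      Continuous.tendsto (by fun_prop) x
    simpa [ContinuousAt] using hlin.add (hF.tendsto_sub_sub_mul x)

theorem mul {k k' Q : ℝ → ℝ} (hF : IsHKPrimitive F f) (hk : ∀ x, HasDerivAt k (k' x) x)
    (hQ : ∀ x, HasDerivAt Q (F x * k' x) x) :
    IsHKPrimitive (fun x => F x * k x - Q x) (fun x => f x * k x) := fun J => by
  have hk_cont : Continuous k := continuous_iff_continuousAt.2 fun x => (hk x).continuousAt
  obtain ⟨M, hM⟩ := J.isCompact_Icc.exists_bound_of_continuousOn
    (f := fun x => k (x 0)) (by fun_prop)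
  have hstieltjes (x : ℝ) : HasDerivAt (fun y => F y * k x - (F y * k y - Q y)) 0 x := by
    have hprod : HasDerivAt (fun y => F y * (k y - k x)) (F x * k' x) x := by
      refine hasDerivAt_iff_tendsto_slope.2 (((hF.continuous.tendsto x).mono_left
        nhdsWithin_le_nhds |>.mul (hasDerivAt_iff_tendsto_slope.1 (hk x))).congr fun y => ?_)
      simp only [slope_def_field, sub_self, mul_zero, sub_zero, mul_div_assoc]
    exact ((hQ x).fun_sub hprod).congr_deriv (sub_self _) |>.congr_of_eventuallyEq
      (.of_forall fun y => by ring)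
  simpa only [smul_eq_mul, mul_comm] using hasIntegral_smul_of_hasIntegral_toSMul
    (fun J _ => hF J) hM (hasIntegral_toSMul_endpointDiff hstieltjes J)

theorem mul_of_continuous {k k' : ℝ → ℝ} (hF : IsHKPrimitive F f)
    (hk : ∀ x, HasDerivAt k (k' x) x) (hk' : Continuous k') :
    IsHKPrimitive (fun x => F x * k x - ∫ y in (0 : ℝ)..x, F y * k' y) (fun x => f x * k x) :=
  hF.mul hk fun x => (hF.continuous.mul hk').integral_hasStrictDerivAt 0 x |>.hasDerivAt

theorem exists_periodic_sub_mul (hF : IsHKPrimitive F f) {T : ℝ} (hf : f.Periodic T)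
    (hT : T ≠ 0) :
    ∃ m : ℝ, Function.Periodic (fun x => F x - m * x) T ∧
      IsHKPrimitive (fun x => F x - m * x) (fun x => f x - m) := by
  have hshift (x : ℝ) : F (x + T) - F (0 + T) = F x - F 0 := by
    have htranslate := hF.comp_add_const T
    simp only [hf _] at htranslate
    exact htranslate.sub_eq_sub hF 0 x
  refine ⟨(F T - F 0) / T, fun x => ?_, hF.sub (isHKPrimitive_of_hasDerivAt fun x => ?_)⟩
  · have := hshift x
    rw [zero_add] at this
    linear_combination this - div_mul_cancel₀ (F T - F 0) hT
  · simpa using (hasDerivAt_id x).const_mul ((F T - F 0) / T)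

end IsHKPrimitive

end Primitive

section CirclePoissonKernel

open Complex MeasureTheory
open scoped Real

variable {r : ℝ}

theorem circleAverage_eq_integral_neg_pi_pi {E : Type*} [NormedAddCommGroup E] [NormedSpace ℝ E]
    (g : ℂ → E) (c : ℂ) (R : ℝ) :
    Real.circleAverage g c R = (2 * π)⁻¹ • ∫ φ in -π..π, g (circleMap c R φ) := by
  have hshift := ((periodic_circleMap c R).comp g).intervalIntegral_add_eq (-π) 0
  rw [zero_add, show -π + 2 * π = π by ring] at hshift
  rw [Real.circleAverage_def]
  exact congrArg _ hshift.symm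

theorem integral_neg_pi_pi_comp_add {q : ℝ → ℝ} (hq : q.Periodic (2 * π)) (θ : ℝ) :
    ∫ φ in -π..π, q (φ + θ) = ∫ φ in -π..π, q φ := by
  have hshift := hq.intervalIntegral_add_eq (-π + θ) (-π)
  rw [intervalIntegral.integral_comp_add_right]
  convert hshift using 2 <;> ring

theorem ofReal_mul_exp_mem_disc (h0 : 0 ≤ r) (h1 : r < 1) (θ : ℝ) :
    (r * exp (θ * I) : ℂ) ∈ disc := by
  simp [disc, abs_of_nonneg h0, h1]

theorem circlePoissonKernel_sub_eq_re (r θ φ : ℝ) :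
    circlePoissonKernel r (φ - θ) =
      (herglotzRieszKernel 0 (r * exp (θ * I)) (circleMap 0 1 φ)).re / (2 * π) := by
  have hnum : ‖circleMap 0 1 φ - 0‖ ^ 2 - ‖(r * exp (θ * I) : ℂ) - 0‖ ^ 2 = 1 - r ^ 2 := by
    simp
  have hdenom : ‖circleMap 0 1 φ - 0 - ((r * exp (θ * I) : ℂ) - 0)‖ ^ 2 =
      1 - 2 * r * Real.cos (φ - θ) + r ^ 2 := by
    rw [← normSq_eq_norm_sq, normSq_apply]
    simp only [circleMap, sub_zero, zero_add, ofReal_one, one_mul, exp_ofReal_mul_I, sub_re,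
      sub_im, mul_re, mul_im, add_re, add_im, ofReal_re, ofReal_im, I_re, I_im, Real.cos_sub]
    linear_combination Real.sin_sq_add_cos_sq φ + r ^ 2 * Real.sin_sq_add_cos_sq θ
  rw [← Function.comp_apply (f := re), ← poissonKernel_eq_re_herglotzRieszKernel,
    poissonKernel_def, hnum, hdenom, circlePoissonKernel, div_div, mul_comm (2 * π)]

theorem circlePoissonKernel_sub_arg (w : ℂ) (φ : ℝ) :
    circlePoissonKernel ‖w‖ (φ - arg w) =
      (herglotzRieszKernel 0 w (circleMap 0 1 φ)).re / (2 * π) := by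
  rw [circlePoissonKernel_sub_eq_re, norm_mul_exp_arg_mul_I]

theorem circlePoissonKernel_denom_pos (h0 : 0 ≤ r) (h1 : r < 1) (θ : ℝ) :
    0 < 1 - 2 * r * Real.cos θ + r ^ 2 := by
  nlinarith [mul_nonneg h0 (sub_nonneg.2 (Real.cos_le_one θ)), pow_pos (sub_pos.2 h1) 2]

theorem continuous_circlePoissonKernel (h0 : 0 ≤ r) (h1 : r < 1) :
    Continuous (circlePoissonKernel r) :=
  Continuous.div (by fun_prop) (by fun_prop) fun θ =>
    (mul_pos Real.two_pi_pos (circlePoissonKernel_denom_pos h0 h1 θ)).ne'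

theorem circlePoissonKernel_nonneg (h0 : 0 ≤ r) (h1 : r < 1) (θ : ℝ) :
    0 ≤ circlePoissonKernel r θ :=
  div_nonneg (by nlinarith)
    (mul_pos Real.two_pi_pos (circlePoissonKernel_denom_pos h0 h1 θ)).le

theorem periodic_circlePoissonKernel (r : ℝ) :
    (circlePoissonKernel r).Periodic (2 * π) := fun θ => by
  rw [circlePoissonKernel, circlePoissonKernel, Real.cos_add_two_pi]

theorem circlePoissonKernel_neg (r θ : ℝ) :
    circlePoissonKernel r (-θ) = circlePoissonKernel r θ := by
  rw [circlePoissonKernel, circlePoissonKernel, Real.cos_neg]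

theorem circlePoissonKernel_mul_one_sub_cos_le (h0 : 0 < r) (h1 : r < 1) (θ : ℝ) :
    circlePoissonKernel r θ * (1 - Real.cos θ) ≤ (1 - r ^ 2) / (4 * π * r) := by
  have hdenom := circlePoissonKernel_denom_pos h0.le h1 θ
  have hpi := Real.pi_pos
  have hnum : 0 ≤ 1 - r ^ 2 := by nlinarith
  rw [circlePoissonKernel, div_mul_eq_mul_div, div_le_div_iff₀ (by positivity) (by positivity),
    mul_assoc]
  refine mul_le_mul_of_nonneg_left ?_ hnum
  linarith [mul_nonneg hpi.le (sq_nonneg (1 - r))]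

theorem integral_circlePoissonKernel_sub (h0 : 0 ≤ r) (h1 : r < 1) (θ : ℝ) :
    ∫ φ in -π..π, circlePoissonKernel r (φ - θ) = 1 := by
  have hmean := InnerProductSpace.HarmonicOnNhd.circleAverage_re_herglotzRieszKernel_smul
    (f := fun _ => (1 : ℝ)) (fun z _ => InnerProductSpace.harmonicAt_const 1)
    (ofReal_mul_exp_mem_disc h0 h1 θ)
  rw [circleAverage_eq_integral_neg_pi_pi, smul_eq_mul, inv_mul_eq_div,
    ← intervalIntegral.integral_div] at hmean
  simpa [circlePoissonKernel_sub_eq_re] using hmean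

theorem integral_circlePoissonKernel (h0 : 0 ≤ r) (h1 : r < 1) :
    ∫ φ in -π..π, circlePoissonKernel r φ = 1 := by
  simpa using integral_circlePoissonKernel_sub h0 h1 0

theorem abs_integral_circlePoissonKernel_mul_le {g : ℝ → ℝ} {C : ℝ} (h0 : 0 ≤ r) (h1 : r < 1)
    (hg : ∀ φ, |g φ| ≤ C) : |∫ φ in -π..π, circlePoissonKernel r φ * g φ| ≤ C := by
  have hbound (φ : ℝ) : ‖circlePoissonKernel r φ * g φ‖ ≤ circlePoissonKernel r φ * C := by
    rw [norm_mul, Real.norm_of_nonneg (circlePoissonKernel_nonneg h0 h1 φ)]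
    exact mul_le_mul_of_nonneg_left (hg φ) (circlePoissonKernel_nonneg h0 h1 φ)
  calc |∫ φ in -π..π, circlePoissonKernel r φ * g φ|
      ≤ ∫ φ in -π..π, circlePoissonKernel r φ * C :=
        intervalIntegral.norm_integral_le_of_norm_le (by linarith [Real.pi_pos])
          (.of_forall fun φ _ => hbound φ)
          (((continuous_circlePoissonKernel h0 h1).mul_const C).intervalIntegrable _ _)
    _ = C := by
        rw [intervalIntegral.integral_mul_const, integral_circlePoissonKernel h0 h1, one_mul]

theorem eventually_nhdsLT_one_mem_Ioo : ∀ᶠ r : ℝ in 𝓝[<] 1, r ∈ Set.Ioo 0 1 :=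
  Ioo_mem_nhdsLT one_pos

theorem tendstoUniformlyOn_circlePoissonKernel {u : Set ℝ} (hu : u ∈ 𝓝 0) :
    TendstoUniformlyOn circlePoissonKernel 0 (𝓝[<] 1) (Set.Ioc (-π) π \ u) := by
  obtain ⟨δ, hδ, hball⟩ := Metric.mem_nhds_iff.1 hu
  have hlim : Tendsto (fun r : ℝ => (1 - r ^ 2) / (4 * π * r) / (2 / π ^ 2 * δ ^ 2))
      (𝓝[<] 1) (𝓝 0) := by
    have hcont : ContinuousAt
        (fun r : ℝ => (1 - r ^ 2) / (4 * π * r) / (2 / π ^ 2 * δ ^ 2)) 1 :=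
      (ContinuousAt.div (by fun_prop) (by fun_prop) (by positivity)).div_const _
    simpa using hcont.tendsto.mono_left nhdsWithin_le_nhds
  refine Metric.tendstoUniformlyOn_iff.2 fun ε hε => ?_
  filter_upwards [hlim.eventually (gt_mem_nhds hε), eventually_nhdsLT_one_mem_Ioo]
    with r hr ⟨h0, h1⟩ φ ⟨hφ, hφu⟩
  have hnonneg := circlePoissonKernel_nonneg h0.le h1 φ
  have hδφ : δ ≤ |φ| := not_lt.1 fun h => hφu (hball (by simpa using h))
  have hcos : 2 / π ^ 2 * δ ^ 2 ≤ 1 - Real.cos φ := by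
    have hquadratic := Real.cos_le_one_sub_mul_cos_sq (abs_le.2 ⟨hφ.1.le, hφ.2⟩)
    have hsq : 2 / π ^ 2 * δ ^ 2 ≤ 2 / π ^ 2 * φ ^ 2 := by
      rw [← sq_abs φ]
      gcongr
    linarith
  rw [Pi.zero_apply, dist_zero_left, Real.norm_of_nonneg hnonneg]
  refine lt_of_le_of_lt ((le_div_iff₀ (by positivity)).2 ?_) hr
  exact (mul_le_mul_of_nonneg_left hcos hnonneg).trans
    (circlePoissonKernel_mul_one_sub_cos_le h0 h1 φ)

theorem tendsto_integral_circlePoissonKernel_mul {g : ℝ → ℝ}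
    (hg : IntervalIntegrable g volume (-π) π) (hg0 : ContinuousAt g 0) :
    Tendsto (fun r => ∫ φ in -π..π, circlePoissonKernel r φ * g φ) (𝓝[<] 1) (𝓝 (g 0)) := by
  have hpi : -π ≤ π := by linarith [Real.pi_pos]
  have hmem : Set.Ioc (-π) π ∈ 𝓝[Set.Ioc (-π) π] 0 := self_mem_nhdsWithin
  simp only [intervalIntegral.integral_of_le hpi]
  refine tendsto_setIntegral_peak_smul_of_integrableOn_of_tendsto measurableSet_Ioc
    measurableSet_Ioc subset_rfl hmem measure_Ioc_lt_top.ne ?_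
    (fun u hu h0u => tendstoUniformlyOn_circlePoissonKernel (hu.mem_nhds h0u))
    (tendsto_const_nhds.congr' ?_) ?_ hg.1 (hg0.mono_left nhdsWithin_le_nhds)
  all_goals filter_upwards [eventually_nhdsLT_one_mem_Ioo] with r ⟨h0, h1⟩
  · exact fun φ _ => circlePoissonKernel_nonneg h0.le h1 φ
  · rw [← intervalIntegral.integral_of_le hpi, integral_circlePoissonKernel h0.le h1]
  · exact (continuous_circlePoissonKernel h0.le h1).aestronglyMeasurable

theorem tendsto_integral_circlePoissonKernel {δ : ℝ} (h0 : 0 < δ) (hδ : δ ≤ π) :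
    Tendsto (fun r => ∫ φ in -δ..δ, circlePoissonKernel r φ) (𝓝[<] 1) (𝓝 1) := by
  have hmem : Set.Ioc (-δ) δ ∈ 𝓝 0 := Ioc_mem_nhds (neg_lt_zero.2 h0) h0
  have hpi : -π ≤ π := by linarith
  have hintegrable : IntervalIntegrable ((Set.Ioc (-δ) δ).indicator (1 : ℝ → ℝ)) volume (-π) π :=
    (intervalIntegrable_iff_integrableOn_Ioc_of_le hpi).2
      ((integrableOn_const measure_Ioc_lt_top.ne).indicator measurableSet_Ioc)
  have hcont : ContinuousAt ((Set.Ioc (-δ) δ).indicator (1 : ℝ → ℝ)) 0 :=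
    continuousAt_const.congr
      (mem_of_superset hmem fun φ hφ => (Set.indicator_of_mem hφ (1 : ℝ → ℝ)).symm)
  have hlim := tendsto_integral_circlePoissonKernel_mul hintegrable hcont
  rw [Set.indicator_of_mem (mem_of_mem_nhds hmem), Pi.one_apply] at hlim
  refine hlim.congr fun r => ?_
  have hinter : Set.Ioc (-π) π ∩ Set.Ioc (-δ) δ = Set.Ioc (-δ) δ :=
    Set.inter_eq_self_of_subset_right (Set.Ioc_subset_Ioc (neg_le_neg hδ) hδ)
  simp only [← Set.indicator_mul_right, Pi.one_apply, mul_one]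
  rw [intervalIntegral.integral_of_le hpi, intervalIntegral.integral_of_le (by linarith),
    setIntegral_indicator measurableSet_Ioc, hinter]

end CirclePoissonKernel

section HerglotzIntegral

open Complex MeasureTheory
open scoped Real

/-- The Herglotz integral of boundary values `g` on the unit circle, a holomorphic function on
the disc whose real part is the Poisson integral of `g`. -/
noncomputable def herglotzIntegral (g : ℂ → ℝ) (w : ℂ) : ℂ :=
  Real.circleAverage (fun ζ => herglotzRieszKernel 0 w ζ • (g ζ : ℂ)) 0 1

theorem circleIntegrable_ofReal {g : ℂ → ℝ} {c : ℂ} {R : ℝ} (hg : CircleIntegrable g c R) :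
    CircleIntegrable (fun ζ => (g ζ : ℂ)) c R :=
  ⟨hg.1.ofReal, hg.2.ofReal⟩

theorem re_circleAverage_smul_ofReal {q : ℂ → ℂ} {g : ℂ → ℝ} {c : ℂ} {R : ℝ}
    (hq : ContinuousOn q (Metric.sphere c |R|)) (hg : CircleIntegrable g c R) :
    (Real.circleAverage (fun ζ => q ζ • (g ζ : ℂ)) c R).re =
      Real.circleAverage (fun ζ => (q ζ).re * g ζ) c R := by
  have hcomm := reCLM.circleAverage_comp_comm ((circleIntegrable_ofReal hg).continuousOn_smul hq)
  simpa [Function.comp_def, Pi.mul_def] using hcomm.symm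

variable {g : ℂ → ℝ} {w : ℂ}

theorem analyticOnNhd_herglotzIntegral (hg : CircleIntegrable g 0 1) :
    AnalyticOnNhd ℂ (herglotzIntegral g) disc :=
  analyticOnNhd_circleAverage_herglotzRieszKernel_smul (circleIntegrable_ofReal hg)

theorem re_herglotzIntegral (hg : CircleIntegrable g 0 1) (hw : w ∈ disc) :
    (herglotzIntegral g w).re =
      ∫ φ in -π..π, circlePoissonKernel ‖w‖ (φ - arg w) * g (circleMap 0 1 φ) := by
  rw [herglotzIntegral, re_circleAverage_herglotzRieszKernel_smul hg hw,
    circleAverage_eq_integral_neg_pi_pi, smul_eq_mul, ← intervalIntegral.integral_const_mul]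
  refine intervalIntegral.integral_congr fun φ _ => ?_
  simp only [circlePoissonKernel_sub_arg, Pi.smul_apply', Function.comp_apply, smul_eq_mul]
  ring

theorem circleMap_sub_ne_zero (hw : w ∈ disc) (φ : ℝ) : circleMap 0 1 φ - w ≠ 0 :=
  sub_ne_zero.2 (circleMap_ne_mem_ball hw φ)

/-- The angular derivative `∂/∂φ` of the Poisson kernel `Φ_r(φ - θ)` at `w = r e^{iθ}`, written
through the Herglotz–Riesz kernel so that it can be compared with `deriv (herglotzIntegral g)`. -/
noncomputable def circlePoissonKernelDeriv (w : ℂ) (φ : ℝ) : ℝ :=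
  -(I * w * (2 * circleMap 0 1 φ / (circleMap 0 1 φ - w) ^ 2)).re / (2 * π)

theorem hasDerivAt_circlePoissonKernel_sub_arg (hw : w ∈ disc) (φ : ℝ) :
    HasDerivAt (fun φ => circlePoissonKernel ‖w‖ (φ - arg w))
      (circlePoissonKernelDeriv w φ) φ := by
  have hne := circleMap_sub_ne_zero hw φ
  have hkernel : HasDerivAt (fun φ : ℝ => herglotzRieszKernel 0 w (circleMap 0 1 φ))
      (-(I * w * (2 * circleMap 0 1 φ / (circleMap 0 1 φ - w) ^ 2))) φ := by
    have hcircle := hasDerivAt_circleMap 0 1 φ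
    simp only [herglotzRieszKernel_def, sub_zero]
    refine ((hcircle.add_const w).fun_div (hcircle.sub_const w) hne).congr_deriv ?_
    field_simp
    ring
  simp only [circlePoissonKernel_sub_arg]
  exact (reCLM.hasFDerivAt.comp_hasDerivAt φ hkernel).div_const (2 * π)

theorem continuous_circlePoissonKernelDeriv (hw : w ∈ disc) :
    Continuous (circlePoissonKernelDeriv w) := by
  have hkernel : Continuous fun φ => 2 * circleMap 0 1 φ / (circleMap 0 1 φ - w) ^ 2 :=
    Continuous.div (by fun_prop) (by fun_prop) fun φ => pow_ne_zero 2 (circleMap_sub_ne_zero hw φ)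
  unfold circlePoissonKernelDeriv
  fun_prop

theorem re_I_mul_self_mul_deriv_herglotzIntegral (hg : CircleIntegrable g 0 1) (hw : w ∈ disc) :
    (I * w * deriv (herglotzIntegral g) w).re =
      -∫ φ in -π..π, g (circleMap 0 1 φ) * circlePoissonKernelDeriv w φ := by
  have hcont : ContinuousOn (fun ζ => I * w * (2 * ζ / (ζ - w) ^ 2)) (Metric.sphere 0 |1|) :=
    continuousOn_const.mul (ContinuousOn.div (by fun_prop) (by fun_prop) fun ζ hζ => by
      rintro h
      simp_all [disc, sub_eq_zero])
  have hderiv := hasDerivAt_circleAverage_herglotzRieszKernel_smul (circleIntegrable_ofReal hg) hw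
  rw [HasDerivAt.deriv (f := herglotzIntegral g) hderiv, ← smul_eq_mul,
    ← Real.circleAverage_fun_smul]
  simp only [← smul_assoc]
  simp only [smul_eq_mul (a := I * w)]
  rw [re_circleAverage_smul_ofReal hcont hg, circleAverage_eq_integral_neg_pi_pi, smul_eq_mul,
    ← intervalIntegral.integral_const_mul, ← intervalIntegral.integral_neg]
  refine intervalIntegral.integral_congr fun φ _ => ?_
  simp only [circlePoissonKernelDeriv]
  ring

end HerglotzIntegral

section PoissonIntegral

open Complex MeasureTheory
open scoped Real

variable {F f g : ℝ → ℝ} {r : ℝ} {w : ℂ}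

theorem hkIntegral_of_continuous {q : ℝ → ℝ} (hq : Continuous q) {a b : ℝ} (hab : a ≤ b) :
    hkIntegral q a b = ∫ x in a..b, q x := by
  rw [(isHKPrimitive_of_hasDerivAt
    fun x => (hq.integral_hasStrictDerivAt 0 x).hasDerivAt).hkIntegral_eq hab]
  exact intervalIntegral.integral_interval_sub_left (hq.intervalIntegrable _ _)
    (hq.intervalIntegrable _ _)

theorem hkIntegral_sub {a b : ℝ} (hf : HKIntegrable f a b) (hg : HKIntegrable g a b) :
    hkIntegral (f - g) a b = hkIntegral f a b - hkIntegral g a b := by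
  unfold hkIntegral
  split_ifs with h
  · exact BoxIntegral.integral_sub (hf h) (hg h)
  · exact (sub_zero 0).symm

theorem hkIntegrable_mul_circlePoissonKernel (hf : ∀ a b, HKIntegrable f a b) (hw : w ∈ disc)
    (a b : ℝ) : HKIntegrable (fun φ => f φ * circlePoissonKernel ‖w‖ (φ - arg w)) a b := by
  obtain ⟨F, hF⟩ := exists_isHKPrimitive hf
  exact (hF.mul_of_continuous (hasDerivAt_circlePoissonKernel_sub_arg hw)
    (continuous_circlePoissonKernelDeriv hw)).hkIntegrable a b

theorem poissonIntegral_sub (hf : ∀ a b, HKIntegrable f a b) (hg : ∀ a b, HKIntegrable g a b)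
    (hw : w ∈ disc) : poissonIntegral (f - g) w = poissonIntegral f w - poissonIntegral g w := by
  simp only [poissonIntegral, Pi.sub_apply, sub_mul]
  exact hkIntegral_sub (hkIntegrable_mul_circlePoissonKernel hf hw _ _)
    (hkIntegrable_mul_circlePoissonKernel hg hw _ _)

theorem poissonIntegral_const (m : ℝ) (hw : w ∈ disc) : poissonIntegral (fun _ => m) w = m := by
  have hnorm : ‖w‖ < 1 := mem_ball_zero_iff.1 hw
  have hK : Continuous fun φ => circlePoissonKernel ‖w‖ (φ - arg w) :=
    (continuous_circlePoissonKernel (norm_nonneg w) hnorm).comp (by fun_prop)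
  rw [poissonIntegral, hkIntegral_of_continuous (by fun_prop) (by linarith [Real.pi_pos]),
    intervalIntegral.integral_const_mul, integral_circlePoissonKernel_sub (norm_nonneg w) hnorm,
    mul_one]

theorem poissonIntegral_eq_sub_const_add (hf : ∀ a b, HKIntegrable f a b) (m : ℝ)
    (hw : w ∈ disc) : poissonIntegral f w = poissonIntegral (fun φ => f φ - m) w + m := by
  have hconst := isHKPrimitive_of_hasDerivAt (F := fun x => x * m) (f := fun _ => m)
    fun x => by simpa using (hasDerivAt_id x).mul_const m
  have hsub := poissonIntegral_sub hf hconst.hkIntegrable hw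
  rw [poissonIntegral_const m hw] at hsub
  exact sub_eq_iff_eq_add.1 hsub.symm

theorem apply_arg_circleMap (hF : F.Periodic (2 * π)) (φ : ℝ) :
    F (arg (circleMap 0 1 φ)) = F φ := by
  rw [circleMap, zero_add, ofReal_one, one_mul, arg_exp_mul_I, toIocMod, hF.sub_zsmul_eq]

theorem circleIntegrable_comp_arg (hF : F.Periodic (2 * π)) (hcont : Continuous F) :
    CircleIntegrable (F ∘ arg) 0 1 := by
  simp only [CircleIntegrable, Function.comp_apply, apply_arg_circleMap hF]
  exact hcont.intervalIntegrable _ _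

theorem re_herglotzIntegral_comp_arg (hF : F.Periodic (2 * π)) (hcont : Continuous F)
    (h0 : 0 ≤ r) (h1 : r < 1) (θ : ℝ) :
    (herglotzIntegral (F ∘ arg) (r * exp (θ * I))).re =
      ∫ φ in -π..π, circlePoissonKernel r φ * F (φ + θ) := by
  have hperiodic : Function.Periodic (fun φ => circlePoissonKernel r (φ - θ) * F φ) (2 * π) :=
    fun φ => by simp only [hF φ, add_sub_right_comm, periodic_circlePoissonKernel r (φ - θ)]
  rw [re_herglotzIntegral (circleIntegrable_comp_arg hF hcont) (ofReal_mul_exp_mem_disc h0 h1 θ)]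
  simp only [circlePoissonKernel_sub_arg, ← circlePoissonKernel_sub_eq_re, Function.comp_apply,
    apply_arg_circleMap hF]
  simpa only [add_sub_cancel_right] using (integral_neg_pi_pi_comp_add hperiodic θ).symm

namespace IsHKPrimitive

theorem poissonIntegral_eq_of_periodic (hF : IsHKPrimitive F f) (hper : F.Periodic (2 * π))
    (hw : w ∈ disc) :
    poissonIntegral f w = (I * w * deriv (herglotzIntegral (F ∘ arg)) w).re := by
  have hcont : Continuous fun φ => F φ * circlePoissonKernelDeriv w φ :=
    hF.continuous.mul (continuous_circlePoissonKernelDeriv hw)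
  have hK : circlePoissonKernel ‖w‖ (-π - arg w) = circlePoissonKernel ‖w‖ (π - arg w) := by
    rw [← periodic_circlePoissonKernel]
    ring_nf
  have hendpoints : F (-π) = F π := by
    rw [← hper]
    ring_nf
  rw [poissonIntegral, (hF.mul_of_continuous (hasDerivAt_circlePoissonKernel_sub_arg hw)
    (continuous_circlePoissonKernelDeriv hw)).hkIntegral_eq (by linarith [Real.pi_pos]),
    hK, hendpoints, sub_sub_sub_cancel_left, ← neg_sub,
    intervalIntegral.integral_interval_sub_left (hcont.intervalIntegrable _ _)
      (hcont.intervalIntegrable _ _),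
    re_I_mul_self_mul_deriv_herglotzIntegral (circleIntegrable_comp_arg hper hF.continuous) hw]
  simp only [Function.comp_apply, apply_arg_circleMap hper]

theorem hasDerivAt_poissonAverage_of_periodic (hF : IsHKPrimitive F f)
    (hper : F.Periodic (2 * π)) (h0 : 0 ≤ r) (h1 : r < 1) (θ : ℝ) :
    HasDerivAt (fun θ => ∫ φ in -π..π, circlePoissonKernel r φ * F (φ + θ))
      (circleSlice (poissonIntegral f) r θ) θ := by
  have hw := ofReal_mul_exp_mem_disc h0 h1 θ
  have hexp : HasDerivAt (fun θ : ℝ => (r * exp (θ * I) : ℂ)) (I * (r * exp (θ * I))) θ :=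
    (((ofRealCLM.hasDerivAt (x := θ)).mul_const I).cexp.const_mul (r : ℂ)).congr_deriv
      (by simp only [ofRealCLM_apply, ofReal_one]; ring)
  have hherglotz := ((analyticOnNhd_herglotzIntegral
    (circleIntegrable_comp_arg hper hF.continuous)) _ hw).differentiableAt.hasDerivAt
  simp only [← re_herglotzIntegral_comp_arg hper hF.continuous h0 h1]
  rw [circleSlice, hF.poissonIntegral_eq_of_periodic hper hw, mul_comm]
  exact reCLM.hasFDerivAt.comp_hasDerivAt θ (hherglotz.comp θ hexp)

theorem hasDerivAt_poissonAverage (hF : IsHKPrimitive F f) (hf : f.Periodic (2 * π))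
    (h0 : 0 ≤ r) (h1 : r < 1) (θ : ℝ) :
    HasDerivAt (fun θ => ∫ φ in -π..π, circlePoissonKernel r φ * F (φ + θ))
      (circleSlice (poissonIntegral f) r θ) θ := by
  obtain ⟨m, hper, hG⟩ := hF.exists_periodic_sub_mul hf Real.two_pi_pos.ne'
  have hK := continuous_circlePoissonKernel h0 h1
  have hF_cont := hF.continuous
  have hsplit (θ : ℝ) : ∫ φ in -π..π, circlePoissonKernel r φ * F (φ + θ) =
      (∫ φ in -π..π, circlePoissonKernel r φ * (F (φ + θ) - m * (φ + θ))) +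
        ((∫ φ in -π..π, circlePoissonKernel r φ * (m * φ)) + m * θ) := by
    have hmass : m * θ = ∫ φ in -π..π, circlePoissonKernel r φ * (m * θ) := by
      rw [intervalIntegral.integral_mul_const, integral_circlePoissonKernel h0 h1, one_mul]
    rw [hmass, ← intervalIntegral.integral_add, ← intervalIntegral.integral_add]
    · refine intervalIntegral.integral_congr fun φ _ => ?_
      ring
    all_goals exact Continuous.intervalIntegrable (by fun_prop) _ _
  have hlinear : HasDerivAt
      (fun θ => (∫ φ in -π..π, circlePoissonKernel r φ * (m * φ)) + m * θ) m θ := by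
    simpa only [id, mul_one] using ((hasDerivAt_id θ).const_mul m).const_add
      (∫ φ in -π..π, circlePoissonKernel r φ * (m * φ))
  simp only [hsplit]
  rw [circleSlice, poissonIntegral_eq_sub_const_add hF.hkIntegrable m
    (ofReal_mul_exp_mem_disc h0 h1 θ)]
  exact (hG.hasDerivAt_poissonAverage_of_periodic hper h0 h1 θ).add hlinear

theorem hkIntegral_circleSlice_poissonIntegral (hF : IsHKPrimitive F f)
    (hf : f.Periodic (2 * π)) (h0 : 0 ≤ r) (h1 : r < 1) {a b : ℝ} (hab : a ≤ b) :
    hkIntegral (circleSlice (poissonIntegral f) r) a b =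
      ∫ φ in -π..π, circlePoissonKernel r φ * (F (φ + b) - F (φ + a)) := by
  have hK := continuous_circlePoissonKernel h0 h1
  have hF_cont := hF.continuous
  rw [(isHKPrimitive_of_hasDerivAt (hF.hasDerivAt_poissonAverage hf h0 h1)).hkIntegral_eq hab,
    ← intervalIntegral.integral_sub]
  · simp only [mul_sub]
  all_goals exact Continuous.intervalIntegrable (by fun_prop) _ _

theorem tendsto_hkIntegral_circleSlice_poissonIntegral (hF : IsHKPrimitive F f)
    (hf : f.Periodic (2 * π)) {a b : ℝ} (hab : a ≤ b) :
    Tendsto (fun r => hkIntegral (circleSlice (poissonIntegral f) r) a b) (𝓝[<] 1)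
      (𝓝 (F b - F a)) := by
  have hcont : Continuous fun φ => F (φ + b) - F (φ + a) := by
    have := hF.continuous
    fun_prop
  have hlim := tendsto_integral_circlePoissonKernel_mul (hcont.intervalIntegrable _ _)
    hcont.continuousAt
  simp only [zero_add] at hlim
  refine hlim.congr' ?_
  filter_upwards [eventually_nhdsLT_one_mem_Ioo] with r ⟨h0, h1⟩
  exact (hF.hkIntegral_circleSlice_poissonIntegral hf h0.le h1 hab).symm

end IsHKPrimitive

theorem harmonicOnNhd_poissonIntegral (hf : ∀ a b, HKIntegrable f a b)
    (hper : f.Periodic (2 * π)) :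
    InnerProductSpace.HarmonicOnNhd (poissonIntegral f) disc := by
  intro w hw
  obtain ⟨F, hF⟩ := exists_isHKPrimitive hf
  obtain ⟨m, hperG, hG⟩ := hF.exists_periodic_sub_mul hper Real.two_pi_pos.ne'
  set H := herglotzIntegral ((fun x => F x - m * x) ∘ arg)
  have hH : AnalyticAt ℂ (fun z => I * z * deriv H z + m) w :=
    ((analyticAt_const.mul analyticAt_id).mul (analyticOnNhd_herglotzIntegral
      (circleIntegrable_comp_arg hperG hG.continuous) w hw).deriv).add analyticAt_const
  refine (InnerProductSpace.harmonicAt_congr_nhds ?_).2 hH.harmonicAt_re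
  filter_upwards [Metric.isOpen_ball.mem_nhds hw] with z hz
  rw [poissonIntegral_eq_sub_const_add hf m hz, hG.poissonIntegral_eq_of_periodic hperG hz,
    add_re, ofReal_re]

end PoissonIntegral

section Norm

open scoped Real

variable {f g : ℝ → ℝ} {u v : ℂ → ℝ}

theorem alexiewiczNorm_le_iff {C : ℝ≥0∞} :
    alexiewiczNorm f ≤ C ↔
      ∀ a b, a ≤ b → b - a ≤ 2 * π → ENNReal.ofReal |hkIntegral f a b| ≤ C := by
  simp only [alexiewiczNorm, iSup_le_iff, and_imp]

theorem hardyNorm_le_iff {C : ℝ≥0∞} :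
    hardyNorm u ≤ C ↔ ∀ r, 0 ≤ r → r < 1 → alexiewiczNorm (circleSlice u r) ≤ C := by
  simp only [hardyNorm, iSup_le_iff, and_imp]

theorem circleSlice_congr (h : Set.EqOn u v disc) {r : ℝ} (h0 : 0 ≤ r) (h1 : r < 1) :
    circleSlice u r = circleSlice v r :=
  funext fun θ => h (ofReal_mul_exp_mem_disc h0 h1 θ)

theorem hardyNorm_congr (h : Set.EqOn u v disc) : hardyNorm u = hardyNorm v :=
  iSup_congr fun _ => iSup_congr fun hr => congrArg _ (circleSlice_congr h hr.1 hr.2)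

theorem alexiewiczNorm_circleSlice_poissonIntegral_le (hf : ∀ a b, HKIntegrable f a b)
    (hper : f.Periodic (2 * π)) {r : ℝ} (h0 : 0 ≤ r) (h1 : r < 1) :
    alexiewiczNorm (circleSlice (poissonIntegral f) r) ≤ alexiewiczNorm f := by
  obtain htop | hfin := eq_or_ne (alexiewiczNorm f) ⊤
  · exact htop ▸ le_top
  obtain ⟨F, hF⟩ := exists_isHKPrimitive hf
  refine alexiewiczNorm_le_iff.2 fun a b hab hlen => ?_
  rw [ENNReal.ofReal_le_iff_le_toReal hfin,
    hF.hkIntegral_circleSlice_poissonIntegral hper h0 h1 hab]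
  refine abs_integral_circlePoissonKernel_mul_le h0 h1 fun φ => ?_
  rw [← ENNReal.ofReal_le_iff_le_toReal hfin, ← hF.hkIntegral_eq (by linarith)]
  exact alexiewiczNorm_le_iff.1 le_rfl _ _ (by linarith) (by linarith)

theorem alexiewiczNorm_le_hardyNorm_poissonIntegral (hf : ∀ a b, HKIntegrable f a b)
    (hper : f.Periodic (2 * π)) : alexiewiczNorm f ≤ hardyNorm (poissonIntegral f) := by
  obtain ⟨F, hF⟩ := exists_isHKPrimitive hf
  refine alexiewiczNorm_le_iff.2 fun a b hab hlen => ?_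
  rw [hF.hkIntegral_eq hab]
  refine le_of_tendsto (ENNReal.tendsto_ofReal
    (hF.tendsto_hkIntegral_circleSlice_poissonIntegral hper hab).abs) ?_
  filter_upwards [eventually_nhdsLT_one_mem_Ioo] with r ⟨h0, h1⟩
  exact alexiewiczNorm_le_iff.1 (hardyNorm_le_iff.1 le_rfl r h0.le h1) a b hab hlen

theorem hardyNorm_poissonIntegral (hf : ∀ a b, HKIntegrable f a b) (hper : f.Periodic (2 * π)) :
    hardyNorm (poissonIntegral f) = alexiewiczNorm f :=
  (hardyNorm_le_iff.2 fun _ h0 h1 =>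
    alexiewiczNorm_circleSlice_poissonIntegral_le hf hper h0 h1).antisymm
      (alexiewiczNorm_le_hardyNorm_poissonIntegral hf hper)

theorem hardyNorm_poissonIntegral_sub (hf : ∀ a b, HKIntegrable f a b)
    (hg : ∀ a b, HKIntegrable g a b) (hf_per : f.Periodic (2 * π)) (hg_per : g.Periodic (2 * π)) :
    hardyNorm (poissonIntegral f - poissonIntegral g) = alexiewiczNorm (f - g) := by
  have hsub : ∀ a b, HKIntegrable (f - g) a b := fun a b h => (hf a b h).sub (hg a b h)
  rw [← hardyNorm_poissonIntegral hsub (hf_per.sub hg_per)]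
  exact hardyNorm_congr fun w hw => (poissonIntegral_sub hf hg hw).symm

end Norm

section DiscPoissonKernel

open Complex
open scoped Real

/-- The Poisson kernel of the disc with pole at `1`, that is `r e^{iθ} ↦ Φ_r(θ)`. It is the
Poisson integral of a point mass and witnesses that `hHK` contains more than Poisson integrals of
functions in `HK`. -/
noncomputable def discPoissonKernel (z : ℂ) : ℝ :=
  (herglotzRieszKernel 0 z 1).re / (2 * π)

theorem circleSlice_discPoissonKernel (r : ℝ) :
    circleSlice discPoissonKernel r = circlePoissonKernel r := by
  ext θ
  have hone : circleMap 0 1 0 = 1 := by simp [circleMap]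
  rw [← circlePoissonKernel_neg, ← zero_sub, circlePoissonKernel_sub_eq_re, hone]
  rfl

theorem harmonicOnNhd_discPoissonKernel :
    InnerProductSpace.HarmonicOnNhd discPoissonKernel disc := by
  intro w hw
  have hne : 1 - w ≠ 0 := by simpa [circleMap] using circleMap_sub_ne_zero hw 0
  have hanalytic : AnalyticAt ℂ (fun z : ℂ => (1 + z) / (1 - z) / ((2 * π : ℝ) : ℂ)) w :=
    ((analyticAt_const.add analyticAt_id).div (analyticAt_const.sub analyticAt_id) hne).div_const
  convert hanalytic.harmonicAt_re using 1
  ext z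
  rw [div_ofReal_re, discPoissonKernel, herglotzRieszKernel_def, sub_zero, sub_zero]

theorem hardyNorm_discPoissonKernel_le_one : hardyNorm discPoissonKernel ≤ 1 := by
  refine hardyNorm_le_iff.2 fun r h0 h1 => alexiewiczNorm_le_iff.2 fun a b hab hlen => ?_
  have hK := continuous_circlePoissonKernel h0 h1
  have hnonneg := circlePoissonKernel_nonneg h0 h1
  rw [circleSlice_discPoissonKernel, hkIntegral_of_continuous hK hab, ENNReal.ofReal_le_one,
    abs_of_nonneg (intervalIntegral.integral_nonneg hab fun φ _ => hnonneg φ)]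
  calc ∫ φ in a..b, circlePoissonKernel r φ
      ≤ ∫ φ in a..a + 2 * π, circlePoissonKernel r φ :=
        intervalIntegral.integral_mono_interval le_rfl hab (by linarith)
          (.of_forall hnonneg) (hK.intervalIntegrable _ _)
    _ = ∫ φ in -π..-π + 2 * π, circlePoissonKernel r φ :=
        (periodic_circlePoissonKernel r).intervalIntegral_add_eq a (-π)
    _ = 1 := by
        rw [← integral_circlePoissonKernel h0 h1]
        ring_nf

theorem discPoissonKernel_mem_hHK : discPoissonKernel ∈ hHK :=
  ⟨harmonicOnNhd_discPoissonKernel, hardyNorm_discPoissonKernel_le_one.trans_lt ENNReal.one_lt_top⟩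

theorem not_eqOn_poissonIntegral_discPoissonKernel {f : ℝ → ℝ} (hf : ∀ a b, HKIntegrable f a b)
    (hper : f.Periodic (2 * π)) : ¬ Set.EqOn (poissonIntegral f) discPoissonKernel disc := by
  intro heq
  obtain ⟨F, hF⟩ := exists_isHKPrimitive hf
  have hjump {δ : ℝ} (hδ : δ ∈ Set.Ioo 0 π) : F δ - F (-δ) = 1 := by
    have hδ_symm : -δ ≤ δ := by linarith [hδ.1]
    refine tendsto_nhds_unique ((hF.tendsto_hkIntegral_circleSlice_poissonIntegral hper
      hδ_symm).congr' ?_) (tendsto_integral_circlePoissonKernel hδ.1 hδ.2.le)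
    filter_upwards [eventually_nhdsLT_one_mem_Ioo] with r ⟨h0, h1⟩
    rw [circleSlice_congr heq h0.le h1, circleSlice_discPoissonKernel,
      hkIntegral_of_continuous (continuous_circlePoissonKernel h0.le h1) hδ_symm]
  have hcont : Continuous fun δ => F δ - F (-δ) := by
    have := hF.continuous
    fun_prop
  have hlim : Tendsto (fun δ => F δ - F (-δ)) (𝓝[>] 0) (𝓝 0) := by
    simpa using (hcont.tendsto 0).mono_left nhdsWithin_le_nhds
  refine zero_ne_one (tendsto_nhds_unique hlim (tendsto_const_nhds.congr' ?_))
  filter_upwards [Ioo_mem_nhdsGT Real.pi_pos] with δ hδ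
  exact (hjump hδ).symm

end DiscPoissonKernel

end PoissonHK

/-- The Poisson integral is a well-defined isometry from `HK` into, but not onto, `hHK`. -/
theorem mainTheorem7 :
    (∀ f ∈ PoissonHK.HK,
      (∀ z ∈ PoissonHK.disc, PoissonHK.HKIntegrable
        (fun φ => f φ * PoissonHK.circlePoissonKernel ‖z‖ (φ - Complex.arg z))
        (-Real.pi) Real.pi) ∧
      PoissonHK.poissonIntegral f ∈ PoissonHK.hHK ∧
      PoissonHK.hardyNorm (PoissonHK.poissonIntegral f) = PoissonHK.alexiewiczNorm f) ∧
    (∀ f ∈ PoissonHK.HK, ∀ g ∈ PoissonHK.HK,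
      PoissonHK.hardyNorm (PoissonHK.poissonIntegral f - PoissonHK.poissonIntegral g) =
        PoissonHK.alexiewiczNorm (f - g)) ∧
    (∃ u ∈ PoissonHK.hHK, ∀ f ∈ PoissonHK.HK,
      ¬ Set.EqOn (PoissonHK.poissonIntegral f) u PoissonHK.disc) := by
  refine ⟨fun f ⟨hper, hf, hfin⟩ => ?_, fun f ⟨hf_per, hf, _⟩ g ⟨hg_per, hg, _⟩ =>
    PoissonHK.hardyNorm_poissonIntegral_sub hf hg hf_per hg_per, ?_⟩
  · have hnorm := PoissonHK.hardyNorm_poissonIntegral hf hper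
    have hharmonic := PoissonHK.harmonicOnNhd_poissonIntegral hf hper
    exact ⟨fun z hz => PoissonHK.hkIntegrable_mul_circlePoissonKernel hf hz _ _,
      ⟨hharmonic, hnorm.trans_lt hfin⟩, hnorm⟩
  · exact ⟨PoissonHK.discPoissonKernel, PoissonHK.discPoissonKernel_mem_hHK,
      fun f ⟨hper, hf, _⟩ => PoissonHK.not_eqOn_poissonIntegral_discPoissonKernel hf hper⟩
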